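/- Let $(G,u)$ be an abelian lattice-ordered group ($l$-group) with strong unit, i.e. $u\ge 0$ and for every $x\in G$ there is $n\in\mathbb N$ with $|x|\le nu$; such a pair is called an $l_u$-group. Let $\Gamma(G,u)=[0,u]$ be the MV-algebra with $x\oplus y=u\wedge(x+y)$ and $\neg x=u-x$. Let $Sp(G)$ (resp. $Sp(A)$) denote the set of prime (in particular proper) $l$-ideals of $G$ (resp. prime ideals of an MV-algebra $A$). For $P\in Sp(G)$, $u_P=[u]_P$ is the class of $u$ in the totally ordered group $G/P$. For a totally ordered nontrivial MV-algebra $C$, let $C^*$ be Chang's totally ordered group: the set of pairs $(m,a)\in\mathbb Z\times C$ with $(m+1,0)$ identified with $(m,1)$, ordered lexicographically, with $(m,a)+(n,b)=(m+n,a\oplus b)$ if $a\oplus b<1$, $(m,a)+(n,b)=(m+n+1,a\odot b)$ if $a\oplus b=1$, and $-(m,a)=(-m-1,\neg a)$. Put $\imath(a)=(0,a)$. For an MV-algebra $A$ and $a\in A$ let $\imath\,\widehat a\in\prod_{Q\in Sp(A)}(A/Q)^*$ be the section $Q\mapsto\imath([a]_Q)$, and let $A^*$ be the subgroup of this product (with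 pointwise group and lattice structure) generated by all $\imath\,\widehat a$, with unit $\imath\,\widehat 1$. Consider the map $$\upsilon:\prod_{Q\in Sp(\Gamma(G,u))}(\Gamma(G,u)/Q)^*\to\prod_{P\in Sp(G)}(\Gamma(G,u)/(P\cap[0,u]))^*\to\prod_{P\in Sp(G)}\Gamma(G/P,u_P)^*\to\prod_{P\in Sp(G)}G/P$$ composed of reindexing along $P\mapsto P\cap[0,u]$, the maps induced by $[x]_{P\cap[0,u]}\mapsto[x]_P$, and, on each fiber, Chang's map $(m,a)\mapsto m\,u_P+a$. Theorem. The map $\upsilon$ is an isomorphism of $l$-groups, and it sends $\imath\,\widehat 1$ to $([u]_P)_P$. The subgroup $\Gamma(G,u)^*$ is closed under the pointwise lattice operations and has $\imath\,\widehat 1$ as strong unit, so it is an $l_u$-group. The map $\upsilon$ restricts to an isomorphism of $l_u$-groups $\Gamma(G,u)^*\cong(G,u)$: there is a unique map $\upsilon:\Gamma(G,u)^*\to G$ that is an isomorphism of $l$-groups, sends $\imath\,\widehat 1$ to $u$, satisfies $[\upsilon(\sigma)]_P=\upsilon(\sigma)(P)$ for all $\sigma\in\Gamma(G,u)^*$ and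 $P\in Sp(G)$ (on the right $\upsilon$ is the map of products above), and satisfies $\upsilon(\imath\,\widehat x)=x$ for every $x\in[0,u]$. -/

import Mathlib

/-! ## MV-algebras -/

/-- MV-algebras. The truncated sum `x ⊕ y` is written `x + y` and the negation `¬ x` is
written `xᶜ`. -/
class MVAlgebra (A : Type*) extends AddCommMonoid A, Compl A where
  compl_invol : ∀ a : A, aᶜᶜ = a
  add_compl_zero : ∀ a : A, a + (0 : A)ᶜ = (0 : A)ᶜ
  luk : ∀ a b : A, (aᶜ + b)ᶜ + b = (bᶜ + a)ᶜ + a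

namespace MVAlgebra

variable {A : Type*} [MVAlgebra A]

/-- `1 = ¬ 0`. -/
instance instOne : One A := ⟨(0 : A)ᶜ⟩

/-- `a ⊙ b = ¬ (¬ a ⊕ ¬ b)`. -/
def odot (a b : A) : A := (aᶜ + bᶜ)ᶜ

/-- `a ⊖ b = a ⊙ ¬ b = ¬ (¬ a ⊕ b)`. -/
def ominus (a b : A) : A := (aᶜ + b)ᶜ

lemma one_def : (1 : A) = (0 : A)ᶜ := rfl

lemma compl_zero : (0 : A)ᶜ = 1 := rfl

lemma compl_one : (1 : A)ᶜ = 0 := compl_invol 0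

lemma add_one' (a : A) : a + 1 = 1 := add_compl_zero a

lemma one_add' (a : A) : 1 + a = 1 := by rw [add_comm]; exact add_compl_zero a

lemma compl_add_self (a : A) : aᶜ + a = 1 := by
  have h := luk a (1 : A)
  rw [add_one', compl_one, zero_add] at h
  exact h.symm

lemma add_compl_self (a : A) : a + aᶜ = 1 := by rw [add_comm]; exact compl_add_self a

lemma compl_inj {a b : A} (h : aᶜ = bᶜ) : a = b := by
  rw [← compl_invol a, h, compl_invol]

lemma compl_add_trans {a b c : A} (h1 : aᶜ + b = 1) (h2 : bᶜ + c = 1) : aᶜ + c = 1 := by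
  have hb : b = (bᶜ + a)ᶜ + a := by
    have h := luk a b
    rwa [h1, compl_one, zero_add] at h
  have hc : c = (cᶜ + b)ᶜ + b := by
    have h := luk b c
    rwa [h2, compl_one, zero_add] at h
  rw [hc, hb]
  generalize (cᶜ + ((bᶜ + a)ᶜ + a))ᶜ = z
  generalize (bᶜ + a)ᶜ = w
  have : aᶜ + (z + (w + a)) = (aᶜ + a) + (z + w) := by abel
  rw [this, compl_add_self, one_add']

/-- The natural order: `a ≤ b` iff `¬ a ⊕ b = 1`. -/
instance instPartialOrder : PartialOrder A where
  le a b := aᶜ + b = 1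
  le_refl a := compl_add_self a
  le_trans _ _ _ h1 h2 := compl_add_trans h1 h2
  le_antisymm a b h1 h2 := by
    have h := luk a b
    change aᶜ + b = 1 at h1
    change bᶜ + a = 1 at h2
    rw [h1, h2, compl_one, zero_add, zero_add] at h
    exact h.symm

lemma le_def {a b : A} : a ≤ b ↔ aᶜ + b = 1 := Iff.rfl

lemma le_one' (a : A) : a ≤ 1 := add_one' _

lemma zero_le' (a : A) : 0 ≤ a := one_add' _

lemma le_add_right' (a b : A) : a ≤ a + b := by
  rw [le_def, ← add_assoc, compl_add_self, one_add']

lemma add_ominus_of_le {a b : A} (h : a ≤ b) : a + ominus b a = b := by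
  have h' := luk a b
  rw [le_def] at h
  rw [h, compl_one, zero_add] at h'
  rw [add_comm]
  exact h'.symm

lemma ominus_le_iff {a b c : A} : ominus a b ≤ c ↔ a ≤ b + c := by
  rw [le_def, le_def, ominus, compl_invol, add_assoc]

lemma le_add_ominus (a b : A) : a ≤ b + ominus a b := ominus_le_iff.1 le_rfl

lemma add_mono' {a b c d : A} (h1 : a ≤ b) (h2 : c ≤ d) : a + c ≤ b + d := by
  rw [← add_ominus_of_le h1, ← add_ominus_of_le h2]
  have : a + ominus b a + (c + ominus d c) = (a + c) + (ominus b a + ominus d c) := by abel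
  rw [this]
  exact le_add_right' _ _

lemma compl_le_compl' {a b : A} (h : a ≤ b) : bᶜ ≤ aᶜ := by
  rw [le_def, compl_invol, add_comm]
  exact h

lemma odot_comm (a b : A) : odot a b = odot b a := by rw [odot, odot, add_comm]

lemma odot_assoc (a b c : A) : odot (odot a b) c = odot a (odot b c) := by
  simp only [odot, compl_invol, add_assoc]

lemma one_odot (a : A) : odot 1 a = a := by
  rw [odot, compl_one, zero_add, compl_invol]

lemma odot_one (a : A) : odot a 1 = a := by rw [odot_comm, one_odot]

lemma zero_odot (a : A) : odot 0 a = 0 := by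
  rw [odot, compl_zero, one_add', compl_one]

lemma odot_zero (a : A) : odot a 0 = 0 := by rw [odot_comm, zero_odot]

lemma odot_compl_self (a : A) : odot a aᶜ = 0 := by
  rw [odot, compl_invol, compl_add_self, compl_one]

lemma odot_le_right (a b : A) : odot a b ≤ b := by
  rw [le_def, odot, compl_invol, add_assoc, compl_add_self, add_one']

/-- If `a ⊕ b = 1` then `b = ¬ a ⊕ (a ⊙ b)`. -/
lemma eq_compl_add_odot {a b : A} (h : a + b = 1) : b = aᶜ + odot a b := by
  have hle : aᶜ ≤ b := by rw [le_def, compl_invol]; exact h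
  have h' := add_ominus_of_le hle
  have : ominus b aᶜ = odot a b := by rw [ominus, odot, add_comm]
  rw [this] at h'
  exact h'.symm

lemma assoc_high {a b c : A} (h1 : a + b = 1) (h2 : b + c = 1) :
    odot a b + c = a + odot b c := by
  have ha : a = bᶜ + odot b a := eq_compl_add_odot (by rw [add_comm]; exact h1)
  have hc : c = bᶜ + odot b c := eq_compl_add_odot h2
  calc odot a b + c = odot a b + (bᶜ + odot b c) := by rw [← hc]
    _ = (bᶜ + odot b a) + odot b c := by rw [odot_comm a b]; abel
    _ = a + odot b c := by rw [← ha]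

lemma assoc_low {a b c : A} (h1 : odot a b = 0) (h2 : odot b c = 0) :
    odot (a + b) c = odot a (b + c) := by
  have e1 : aᶜ + bᶜ = 1 := by
    apply compl_inj; rw [compl_one]; exact h1
  have e2 : bᶜ + cᶜ = 1 := by
    apply compl_inj; rw [compl_one]; exact h2
  have h := assoc_high e1 e2
  simp only [odot, compl_invol] at h ⊢
  rw [h]

lemma assoc_mid {a b c : A} (h1 : a + b = 1) (h2 : odot b c = 0) :
    odot a b + c = odot a (b + c) := by
  have e2 : bᶜ + cᶜ = 1 := by
    apply compl_inj; rw [compl_one]; exact h2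
  have hb : b = aᶜ + odot a b := eq_compl_add_odot h1
  have hc : cᶜ = b + odot bᶜ cᶜ := by
    have := eq_compl_add_odot e2
    rwa [compl_invol] at this
  have hf : odot bᶜ cᶜ = (b + c)ᶜ := by rw [odot, compl_invol, compl_invol]
  have hle : aᶜ + (b + c)ᶜ ≤ (odot a b)ᶜ := by
    rw [odot, compl_invol]
    exact add_mono' le_rfl (compl_le_compl' (le_add_right' b c))
  have key := add_ominus_of_le (compl_le_compl' hle)
  rw [compl_invol] at key
  apply compl_inj
  have h3 : (aᶜ + (b + c)ᶜ)ᶜ = odot a (b + c) := rfl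
  rw [h3] at key
  rw [← key]
  congr 2
  have hc' : c = (b + odot bᶜ cᶜ)ᶜ := by rw [← hc, compl_invol]
  rw [ominus, ← h3, compl_invol]
  calc c = (b + (b + c)ᶜ)ᶜ := by rw [← hf]; exact hc'
    _ = ((aᶜ + odot a b) + (b + c)ᶜ)ᶜ := by rw [← hb]
    _ = (aᶜ + (b + c)ᶜ + odot a b)ᶜ := by congr 1; abel

end MVAlgebra

open MVAlgebra

/-- Homomorphisms of MV-algebras. -/
structure MVHom (A B : Type*) [MVAlgebra A] [MVAlgebra B] where
  toFun : A → B
  map_zero : toFun 0 = 0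
  map_add : ∀ a b, toFun (a + b) = toFun a + toFun b
  map_compl : ∀ a, toFun aᶜ = (toFun a)ᶜ

lemma MVHom.map_one {A B : Type*} [MVAlgebra A] [MVAlgebra B] (h : MVHom A B) :
    h.toFun 1 = 1 := by
  rw [one_def, h.map_compl, h.map_zero, one_def]

/-- The natural order of the MV-algebra is total. -/
class MVChain (A : Type*) [MVAlgebra A] : Prop where
  total : ∀ a b : A, a ≤ b ∨ b ≤ a

/-! ### Ideals and quotients -/

/-- Ideals of an MV-algebra. -/
structure MVIdeal (A : Type*) [MVAlgebra A] where
  carrier : Set A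
  zero_mem : 0 ∈ carrier
  add_mem : ∀ {a b}, a ∈ carrier → b ∈ carrier → a + b ∈ carrier
  mem_of_le : ∀ {a b}, b ∈ carrier → a ≤ b → a ∈ carrier

namespace MVIdeal

variable {A : Type*} [MVAlgebra A] (I : MVIdeal A)

/-- The congruence of an ideal: `a ≡ b` iff `a ⊖ b` and `b ⊖ a` lie in the ideal. -/
def setoid : Setoid A where
  r a b := ominus a b ∈ I.carrier ∧ ominus b a ∈ I.carrier
  iseqv := by
    have tr : ∀ {x y z : A}, ominus x y ∈ I.carrier → ominus y z ∈ I.carrier →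
        ominus x z ∈ I.carrier := by
      intro x y z h1 h2
      refine I.mem_of_le (I.add_mem h2 h1) ?_
      rw [ominus_le_iff, ← add_assoc]
      exact (le_add_ominus x y).trans (add_mono' (le_add_ominus y z) le_rfl)
    refine ⟨fun a => ?_, fun h => ⟨h.2, h.1⟩, fun h1 h2 => ⟨tr h1.1 h2.1, tr h2.2 h1.2⟩⟩
    have : ominus a a = 0 := by rw [ominus, compl_add_self, compl_one]
    rw [this]
    exact ⟨I.zero_mem, I.zero_mem⟩

/-- The quotient `A / I`. -/
def Quot : Type _ := Quotient I.setoid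

/-- The class `[a]_I`. -/
def cls (a : A) : I.Quot := Quotient.mk I.setoid a

lemma cls_eq_iff {a b : A} :
    I.cls a = I.cls b ↔ ominus a b ∈ I.carrier ∧ ominus b a ∈ I.carrier :=
  ⟨fun h => Quotient.exact (s := I.setoid) h, fun h => Quotient.sound (s := I.setoid) h⟩

lemma add_congr {a b c d : A} (h1 : ominus a c ∈ I.carrier) (h2 : ominus b d ∈ I.carrier) :
    ominus (a + b) (c + d) ∈ I.carrier := by
  refine I.mem_of_le (I.add_mem h1 h2) ?_
  rw [ominus_le_iff]
  have : c + d + (ominus a c + ominus b d) = (c + ominus a c) + (d + ominus b d) := by abel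
  rw [this]
  exact add_mono' (le_add_ominus _ _) (le_add_ominus _ _)

lemma ominus_compl (a b : A) : ominus aᶜ bᶜ = ominus b a := by
  rw [ominus, ominus, compl_invol, add_comm]

instance instZero : Zero I.Quot := ⟨I.cls 0⟩

instance instAdd : Add I.Quot where
  add := Quotient.map₂ (· + ·) fun _ _ h1 _ _ h2 =>
    ⟨I.add_congr h1.1 h2.1, I.add_congr h1.2 h2.2⟩

instance instCompl : Compl I.Quot where
  compl := Quotient.map (·ᶜ) fun a b h => by
    change ominus aᶜ bᶜ ∈ I.carrier ∧ ominus bᶜ aᶜ ∈ I.carrier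
    rw [ominus_compl, ominus_compl]
    exact ⟨h.2, h.1⟩

/-- The quotient MV-algebra, with the operations of representatives. -/
instance instMVAlgebra : MVAlgebra I.Quot where
  nsmul := nsmulRec
  add_assoc := by
    rintro ⟨a⟩ ⟨b⟩ ⟨c⟩; exact congrArg I.cls (add_assoc a b c)
  zero_add := by rintro ⟨a⟩; exact congrArg I.cls (zero_add a)
  add_zero := by rintro ⟨a⟩; exact congrArg I.cls (add_zero a)
  add_comm := by rintro ⟨a⟩ ⟨b⟩; exact congrArg I.cls (add_comm a b)
  compl_invol := by rintro ⟨a⟩; exact congrArg I.cls (compl_invol a)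
  add_compl_zero := by rintro ⟨a⟩; exact congrArg I.cls (add_compl_zero a)
  luk := by rintro ⟨a⟩ ⟨b⟩; exact congrArg I.cls (luk a b)

lemma cls_zero : I.cls 0 = 0 := rfl
lemma cls_one : I.cls 1 = 1 := rfl
lemma cls_add (a b : A) : I.cls (a + b) = I.cls a + I.cls b := rfl
lemma cls_compl (a : A) : I.cls aᶜ = (I.cls a)ᶜ := rfl

lemma cls_le_of_mem {a b : A} (h : ominus a b ∈ I.carrier) : I.cls a ≤ I.cls b := by
  rw [le_def, ← cls_compl, ← cls_add, ← cls_one, cls_eq_iff]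
  have h1 : ominus (aᶜ + b) 1 = 0 := by rw [ominus, add_one', compl_one]
  have h2 : ominus 1 (aᶜ + b) = ominus a b := by
    rw [ominus, compl_one, zero_add]; rfl
  rw [h1, h2]
  exact ⟨I.zero_mem, h⟩

end MVIdeal

/-- Prime ideals of an MV-algebra: proper, and for all `a`, `b` one of `a ⊖ b`, `b ⊖ a` lies in
the ideal. -/
structure PrimeMVIdeal (A : Type*) [MVAlgebra A] extends MVIdeal A where
  ne_univ : carrier ≠ Set.univ
  prime : ∀ a b : A, ominus a b ∈ carrier ∨ ominus b a ∈ carrier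

namespace PrimeMVIdeal

variable {A : Type*} [MVAlgebra A] (Q : PrimeMVIdeal A)

instance instMVChain : MVChain Q.toMVIdeal.Quot where
  total := by
    rintro ⟨a⟩ ⟨b⟩
    rcases Q.prime a b with h | h
    · exact Or.inl (Q.toMVIdeal.cls_le_of_mem h)
    · exact Or.inr (Q.toMVIdeal.cls_le_of_mem h)

instance instNontrivial : Nontrivial Q.toMVIdeal.Quot := by
  refine ⟨⟨1, 0, fun h => Q.ne_univ ?_⟩⟩
  have h' := ((Q.toMVIdeal.cls_eq_iff (a := 1) (b := 0)).1 h).1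
  have h1 : ominus (1 : A) 0 = 1 := by
    rw [ominus, compl_one, zero_add]; rfl
  rw [h1] at h'
  exact Set.eq_univ_of_forall fun a => Q.mem_of_le h' (le_one' a)

end PrimeMVIdeal

/-! ## Chang's construction for a (nontrivial) MV-chain -/

namespace MVAlgebra

lemma zero_ne_one' {A : Type*} [MVAlgebra A] [Nontrivial A] : (0 : A) ≠ 1 := by
  intro h
  obtain ⟨x, y, hxy⟩ := exists_pair_ne A
  have hz : ∀ a : A, a = 0 := fun a => le_antisymm (by rw [h]; exact le_one' a) (zero_le' a)
  exact hxy ((hz x).trans (hz y).symm)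

lemma odot_eq_zero_of_chain {A : Type*} [MVAlgebra A] [MVChain A] {a b : A}
    (h : a + b ≠ 1) : odot a b = 0 := by
  rcases MVChain.total aᶜ b with h' | h'
  · rw [le_def, compl_invol] at h'
    exact absurd h' h
  · rw [le_def, add_comm] at h'
    rw [odot, h', compl_one]

end MVAlgebra

/-- The identification `(m + 1, 0) = (m, 1)` on `ℤ × A`. -/
def changSetoid (A : Type*) [MVAlgebra A] [Nontrivial A] : Setoid (ℤ × A) where
  r p q := p = q ∨ (p.1 = q.1 + 1 ∧ p.2 = 0 ∧ q.2 = 1) ∨ (q.1 = p.1 + 1 ∧ q.2 = 0 ∧ p.2 = 1)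
  iseqv := by
    have h01 : (0 : A) ≠ 1 := zero_ne_one'
    refine ⟨fun _ => Or.inl rfl, ?_, ?_⟩
    · rintro p q (h | h | h)
      · exact Or.inl h.symm
      · exact Or.inr (Or.inr h)
      · exact Or.inr (Or.inl h)
    · rintro ⟨m, a⟩ ⟨n, b⟩ ⟨k, c⟩ h1 h2
      simp only [Prod.mk.injEq] at h1 h2 ⊢
      rcases h1 with ⟨rfl, rfl⟩ | ⟨h, rfl, rfl⟩ | ⟨h, rfl, rfl⟩
      · exact h2
      · rcases h2 with ⟨rfl, rfl⟩ | ⟨h', h'', -⟩ | ⟨h', rfl, -⟩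
        · exact Or.inr (Or.inl ⟨h, rfl, rfl⟩)
        · exact absurd h''.symm h01
        · exact Or.inl ⟨by omega, rfl⟩
      · rcases h2 with ⟨rfl, rfl⟩ | ⟨h', -, rfl⟩ | ⟨h', -, h''⟩
        · exact Or.inr (Or.inr ⟨h, rfl, rfl⟩)
        · exact Or.inl ⟨by omega, rfl⟩
        · exact absurd h'' h01

/-- Chang's `A^*`: pairs `(m, a)` with `m : ℤ`, `a : A`, where `(m + 1, 0) = (m, 1)`. -/
def Chang (A : Type*) [MVAlgebra A] [Nontrivial A] : Type _ := Quotient (changSetoid A)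

namespace Chang

section Basic

variable {A : Type*} [MVAlgebra A] [Nontrivial A]

/-- The element `(m, a)` of `A^*`. -/
def mk (m : ℤ) (a : A) : Chang A := Quotient.mk (changSetoid A) (m, a)

lemma mk_succ_zero (m : ℤ) : mk (m + 1) (0 : A) = mk m 1 :=
  Quotient.sound (s := changSetoid A) (Or.inr (Or.inl ⟨rfl, rfl, rfl⟩))

lemma exists_rep (x : Chang A) : ∃ m a, x = mk m a := by
  obtain ⟨⟨m, a⟩, rfl⟩ := Quotient.exists_rep x
  exact ⟨m, a, rfl⟩

/-- To define a function on `A^*` one has to respect `(m + 1, 0) = (m, 1)`. -/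
def lift {B : Type*} (f : ℤ → A → B) (hf : ∀ m, f (m + 1) 0 = f m 1) (x : Chang A) : B :=
  Quotient.lift (s := changSetoid A) (fun p => f p.1 p.2) (by
    rintro ⟨m, a⟩ ⟨n, b⟩ h
    rcases h with h | ⟨h1, h2, h3⟩ | ⟨h1, h2, h3⟩
    · obtain ⟨rfl, rfl⟩ := Prod.mk.inj h
      rfl
    · simp only at h1 h2 h3 ⊢
      subst h1 h2 h3
      exact hf n
    · simp only at h1 h2 h3 ⊢
      subst h1 h2 h3
      exact (hf m).symm) x

lemma lift_mk {B : Type*} (f : ℤ → A → B) (hf : ∀ m, f (m + 1) 0 = f m 1) (m : ℤ) (a : A) :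
    lift f hf (mk m a) = f m a := rfl

open Classical in
/-- The sum of `(m, a)` and `(n, b)`. -/
noncomputable def addPair (m : ℤ) (a : A) (n : ℤ) (b : A) : Chang A :=
  if a + b = 1 then mk (m + n + 1) (odot a b) else mk (m + n) (a + b)

lemma addPair_comm (m : ℤ) (a : A) (n : ℤ) (b : A) : addPair m a n b = addPair n b m a := by
  unfold addPair
  rw [add_comm a b, add_comm m n, odot_comm]

lemma addPair_glue (m : ℤ) (n : ℤ) (b : A) : addPair (m + 1) 0 n b = addPair m 1 n b := by
  unfold addPair
  rw [if_pos (one_add' b), one_odot, zero_add, zero_odot]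
  split_ifs with h
  · subst h
    rw [mk_succ_zero]
    congr 1; ring
  · congr 1; ring

noncomputable instance instAdd : Add (Chang A) where
  add x y := lift (fun m a => lift (fun n b => addPair m a n b)
    (fun n => by rw [addPair_comm, addPair_glue, addPair_comm]) y)
    (fun m => by
      obtain ⟨n, b, rfl⟩ := exists_rep y
      rw [lift_mk, lift_mk, addPair_glue]) x

lemma mk_add_mk (m : ℤ) (a : A) (n : ℤ) (b : A) : mk m a + mk n b = addPair m a n b := rfl

lemma mk_add_mk_of_eq {a b : A} (h : a + b = 1) (m n : ℤ) :
    mk m a + mk n b = mk (m + n + 1) (odot a b) := by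
  rw [mk_add_mk, addPair, if_pos h]

lemma mk_add_mk_of_ne {a b : A} (h : a + b ≠ 1) (m n : ℤ) :
    mk m a + mk n b = mk (m + n) (a + b) := by
  rw [mk_add_mk, addPair, if_neg h]

instance instZero : Zero (Chang A) := ⟨mk 0 0⟩

lemma zero_def : (0 : Chang A) = mk 0 0 := rfl

instance instNeg : Neg (Chang A) where
  neg := lift (fun m a => mk (-m - 1) aᶜ) (fun m => by
    rw [MVAlgebra.compl_zero, compl_one, ← mk_succ_zero]
    congr 1; ring)

lemma neg_mk (m : ℤ) (a : A) : -mk m a = mk (-m - 1) aᶜ := rfl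

/-- The order: `x ≤ y` iff there are pairs representing `x` and `y` that are so ordered
lexicographically. -/
instance instLE : LE (Chang A) where
  le x y := ∃ m a n b, x = mk m a ∧ y = mk n b ∧ (m < n ∨ (m = n ∧ a ≤ b))

lemma mk_le_mk {m n : ℤ} {a b : A} :
    mk m a ≤ mk n b ↔ m < n ∨ (m = n ∧ a ≤ b) ∨ (m = n + 1 ∧ a = 0 ∧ b = 1) := by
  have h01 : (0 : A) ≠ 1 := zero_ne_one'
  constructor
  · rintro ⟨m', a', n', b', h1, h2, h3⟩
    have e1 := Quotient.exact (s := changSetoid A) h1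
    have e2 := Quotient.exact (s := changSetoid A) h2
    change (m, a) = (m', a') ∨ (m = m' + 1 ∧ a = 0 ∧ a' = 1) ∨ (m' = m + 1 ∧ a' = 0 ∧ a = 1)
      at e1
    change (n, b) = (n', b') ∨ (n = n' + 1 ∧ b = 0 ∧ b' = 1) ∨ (n' = n + 1 ∧ b' = 0 ∧ b = 1)
      at e2
    simp only [Prod.mk.injEq] at e1 e2
    rcases e1 with ⟨rfl, rfl⟩ | ⟨rfl, rfl, rfl⟩ | ⟨rfl, rfl, rfl⟩ <;>
    rcases e2 with ⟨rfl, rfl⟩ | ⟨rfl, rfl, rfl⟩ | ⟨rfl, rfl, rfl⟩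
    · rcases h3 with h | h
      · exact Or.inl h
      · exact Or.inr (Or.inl h)
    · rcases h3 with h | h
      · exact Or.inl (by omega)
      · exact Or.inl (by omega)
    · rcases h3 with h | ⟨h, h'⟩
      · rcases (by omega : m < n ∨ m = n) with h | h
        · exact Or.inl h
        · exact Or.inr (Or.inl ⟨h, le_one' _⟩)
      · exact Or.inr (Or.inr ⟨h, le_antisymm h' (zero_le' _), rfl⟩)
    · rcases h3 with h | ⟨h, h'⟩
      · rcases (by omega : m' + 1 < n ∨ m' + 1 = n) with h | h
        · exact Or.inl h
        · exact Or.inr (Or.inl ⟨h, zero_le' _⟩)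
      · exact Or.inr (Or.inr ⟨by omega, rfl, le_antisymm (le_one' _) h'⟩)
    · rcases h3 with h | ⟨h, h'⟩
      · exact Or.inl (by omega)
      · exact Or.inr (Or.inl ⟨by omega, le_rfl⟩)
    · rcases h3 with h | ⟨h, h'⟩
      · rcases (by omega : m' + 1 < n ∨ m' + 1 = n ∨ m' + 1 = n + 1) with h | h | h
        · exact Or.inl h
        · exact Or.inr (Or.inl ⟨h, zero_le' _⟩)
        · exact Or.inr (Or.inr ⟨h, rfl, rfl⟩)
      · exact absurd (le_antisymm (zero_le' _) h') h01
    · rcases h3 with h | ⟨h, h'⟩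
      · exact Or.inl (by omega)
      · exact Or.inl (by omega)
    · rcases h3 with h | ⟨h, h'⟩
      · exact Or.inl (by omega)
      · exact Or.inl (by omega)
    · rcases h3 with h | ⟨h, h'⟩
      · rcases (by omega : m < n ∨ m = n) with h | h
        · exact Or.inl h
        · exact Or.inr (Or.inl ⟨h, le_rfl⟩)
      · exact Or.inr (Or.inl ⟨by omega, le_rfl⟩)
  · rintro (h | h | ⟨rfl, rfl, rfl⟩)
    · exact ⟨m, a, n, b, rfl, rfl, Or.inl h⟩
    · exact ⟨m, a, n, b, rfl, rfl, Or.inr h⟩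
    · exact ⟨n, 1, n, 1, mk_succ_zero n, rfl, Or.inr ⟨rfl, le_rfl⟩⟩

/-- The inclusion `ι(a) = (0, a)`. -/
def iota (a : A) : Chang A := mk 0 a

/-- The unit `(0, 1)`. -/
def unit (A : Type*) [MVAlgebra A] [Nontrivial A] : Chang A := mk 0 1

/-- The map `(m, a) ↦ (m, h a)` induced by a homomorphism `h`. -/
def map {B : Type*} [MVAlgebra B] [Nontrivial B] (h : MVHom A B) : Chang A → Chang B :=
  lift (fun m a => mk m (h.toFun a)) (fun m => by
    rw [h.map_zero, h.map_one, mk_succ_zero])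

end Basic

section Chain

variable {A : Type*} [MVAlgebra A] [Nontrivial A] [MVChain A]

lemma add_assoc_aux (x y z : Chang A) : x + y + z = x + (y + z) := by
  obtain ⟨m, a, rfl⟩ := exists_rep x
  obtain ⟨n, b, rfl⟩ := exists_rep y
  obtain ⟨k, c, rfl⟩ := exists_rep z
  have mid : ∀ (m n k : ℤ) (a b c : A), a + b = 1 → b + c ≠ 1 →
      mk m a + mk n b + mk k c = mk m a + (mk n b + mk k c) := by
    intro m n k a b c h1 h2
    have h0 := odot_eq_zero_of_chain h2
    have e := assoc_mid h1 h0
    have h3 : odot a b + c ≠ 1 := by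
      intro h
      apply h2
      refine le_antisymm (le_one' _) ?_
      rw [← h]
      exact add_mono' (odot_le_right a b) le_rfl
    have h4 : a + (b + c) = 1 := by rw [← add_assoc, h1, one_add']
    rw [mk_add_mk_of_eq h1, mk_add_mk_of_ne h2, mk_add_mk_of_ne h3, mk_add_mk_of_eq h4, e]
    congr 1; ring
  have comm : ∀ x y : Chang A, x + y = y + x := by
    intro x y
    obtain ⟨m, a, rfl⟩ := exists_rep x
    obtain ⟨n, b, rfl⟩ := exists_rep y
    exact addPair_comm m a n b
  by_cases h1 : a + b = 1 <;> by_cases h2 : b + c = 1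
  · rw [mk_add_mk_of_eq h1, mk_add_mk_of_eq h2]
    have e := assoc_high h1 h2
    by_cases h3 : odot a b + c = 1
    · rw [mk_add_mk_of_eq h3, mk_add_mk_of_eq (e ▸ h3), odot_assoc]
      congr 1; ring
    · rw [mk_add_mk_of_ne h3, mk_add_mk_of_ne (e ▸ h3), e]
      congr 1; ring
  · exact mid m n k a b c h1 h2
  · have h := mid k n m c b a (by rw [add_comm]; exact h2) (by rw [add_comm]; exact h1)
    rw [comm (mk m a + mk n b), comm (mk m a) (mk n b), ← h, comm (mk k c + mk n b),
      comm (mk k c)]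
  · have e := assoc_low (odot_eq_zero_of_chain h1) (odot_eq_zero_of_chain h2)
    rw [mk_add_mk_of_ne h1, mk_add_mk_of_ne h2]
    by_cases h3 : a + b + c = 1
    · rw [mk_add_mk_of_eq h3, mk_add_mk_of_eq (by rw [← add_assoc]; exact h3), e]
      congr 1; ring
    · rw [mk_add_mk_of_ne h3, mk_add_mk_of_ne (by rw [← add_assoc]; exact h3), add_assoc a b c]
      congr 1; ring

noncomputable instance instAddCommGroup : AddCommGroup (Chang A) where
  add_assoc := add_assoc_aux
  zero_add x := by
    obtain ⟨m, a, rfl⟩ := exists_rep x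
    rw [zero_def, mk_add_mk, addPair, zero_add, zero_add, zero_odot]
    split_ifs with h
    · rw [h, mk_succ_zero]
    · rfl
  add_zero x := by
    obtain ⟨m, a, rfl⟩ := exists_rep x
    rw [zero_def, mk_add_mk, addPair, add_zero, add_zero, odot_zero]
    split_ifs with h
    · rw [h, mk_succ_zero]
    · rfl
  nsmul := nsmulRec
  zsmul := zsmulRec
  neg_add_cancel x := by
    obtain ⟨m, a, rfl⟩ := exists_rep x
    rw [neg_mk, mk_add_mk_of_eq (compl_add_self a), odot_comm, odot_compl_self, zero_def]
    congr 1; ring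
  add_comm x y := by
    obtain ⟨m, a, rfl⟩ := exists_rep x
    obtain ⟨n, b, rfl⟩ := exists_rep y
    exact addPair_comm m a n b

noncomputable instance instLinearOrder : LinearOrder (Chang A) where
  le_refl x := by
    obtain ⟨m, a, rfl⟩ := exists_rep x
    exact mk_le_mk.2 (Or.inr (Or.inl ⟨rfl, le_rfl⟩))
  le_trans x y z := by
    obtain ⟨m, a, rfl⟩ := exists_rep x
    obtain ⟨n, b, rfl⟩ := exists_rep y
    obtain ⟨k, c, rfl⟩ := exists_rep z
    have h01 : (0 : A) ≠ 1 := zero_ne_one'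
    simp only [mk_le_mk]
    rintro (h1 | ⟨rfl, h1⟩ | ⟨rfl, rfl, rfl⟩) (h2 | ⟨rfl, h2⟩ | ⟨rfl, h3, rfl⟩)
    · exact Or.inl (by omega)
    · exact Or.inl h1
    · rcases (by omega : m < k ∨ m = k) with h | h
      · exact Or.inl h
      · exact Or.inr (Or.inl ⟨h, le_one' _⟩)
    · exact Or.inl h2
    · exact Or.inr (Or.inl ⟨rfl, h1.trans h2⟩)
    · subst h3
      exact Or.inr (Or.inr ⟨rfl, le_antisymm h1 (zero_le' _), rfl⟩)
    · rcases (by omega : n + 1 < k ∨ n + 1 = k) with h | h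
      · exact Or.inl h
      · exact Or.inr (Or.inl ⟨h, zero_le' _⟩)
    · exact Or.inr (Or.inr ⟨rfl, rfl, le_antisymm (le_one' _) h2⟩)
    · exact absurd h3.symm h01
  le_antisymm x y := by
    obtain ⟨m, a, rfl⟩ := exists_rep x
    obtain ⟨n, b, rfl⟩ := exists_rep y
    simp only [mk_le_mk]
    rintro (h1 | ⟨rfl, h1⟩ | ⟨rfl, rfl, rfl⟩) (h2 | ⟨h2, h2'⟩ | ⟨h2, h2', h2''⟩)
    · omega
    · omega
    · subst h2 h2' h2''
      exact (mk_succ_zero m).symm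
    · omega
    · rw [le_antisymm h1 h2']
    · omega
    · exact mk_succ_zero n
    · omega
    · omega
  le_total x y := by
    obtain ⟨m, a, rfl⟩ := exists_rep x
    obtain ⟨n, b, rfl⟩ := exists_rep y
    simp only [mk_le_mk]
    rcases lt_trichotomy m n with h | rfl | h
    · exact Or.inl (Or.inl h)
    · rcases MVChain.total a b with h | h
      · exact Or.inl (Or.inr (Or.inl ⟨rfl, h⟩))
      · exact Or.inr (Or.inr (Or.inl ⟨rfl, h⟩))
    · exact Or.inr (Or.inl h)
  toDecidableLE := Classical.decRel _

end Chain

end Chang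

/-! ## The extension of Chang's construction to arbitrary MV-algebras -/

section MVStar

variable (A : Type*) [MVAlgebra A]

/-- The product `∏_{Q ∈ Sp(A)} (A/Q)^*`, with pointwise structure. -/
abbrev StarProd : Type _ := ∀ Q : PrimeMVIdeal A, Chang Q.toMVIdeal.Quot

variable {A}

/-- The section `ι â`, with `(ι â)(Q) = ι([a]_Q)`. -/
def iotaHat (a : A) : StarProd A := fun Q => Chang.iota (Q.toMVIdeal.cls a)

variable (A)

/-- The unit `u = ι 1̂` of the product. -/
def starUnit : StarProd A := iotaHat 1

/-- `A^*`: the subgroup of the product generated by the image `A°` of `a ↦ ι â`. -/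
noncomputable def mvStar : AddSubgroup (StarProd A) :=
  AddSubgroup.closure (Set.range (iotaHat (A := A)))

variable {A}

lemma iotaHat_mem (a : A) : iotaHat a ∈ mvStar A := AddSubgroup.subset_closure ⟨a, rfl⟩

end MVStar

/-! ## Abelian l-groups with strong unit -/

/-- A strong unit of an abelian l-group `G`: an element `u ≥ 0` such that every `x` satisfies
`|x| ≤ n u` for some natural number `n`. -/
class LuGroup (G : Type*) [AddCommGroup G] [Lattice G] [IsOrderedAddMonoid G] where
  unit : G
  unit_nonneg : 0 ≤ unit
  exists_abs_le : ∀ x : G, ∃ n : ℕ, |x| ≤ n • unit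

/-- The segment `Γ(G, u) = [0, u]`. -/
def Segment (G : Type*) [AddCommGroup G] [Lattice G] [IsOrderedAddMonoid G] [LuGroup G] :
    Type _ :=
  {x : G // 0 ≤ x ∧ x ≤ LuGroup.unit}

namespace Segment

section Aux

variable {G : Type*} [AddCommGroup G] [Lattice G] [IsOrderedAddMonoid G]

lemma add_aux {u x y z : G} (hz : 0 ≤ z) : u ⊓ (u ⊓ (x + y) + z) = u ⊓ (x + y + z) := by
  rw [inf_add, ← inf_assoc, inf_of_le_left (le_add_of_nonneg_right hz)]

lemma luk_aux {u x y : G} (hx : x ≤ u) (hy : y ≤ u) :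
    u ⊓ (u - u ⊓ (u - x + y) + y) = x ⊔ y := by
  have : u - u ⊓ (u - x + y) + y = x ⊔ y := by
    rw [sub_inf, sup_add, sub_self, zero_add]
    have : u - (u - x + y) + y = x := by abel
    rw [this, sup_comm]
  rw [this]
  exact inf_of_le_right (sup_le hx hy)

end Aux

variable {G : Type*} [AddCommGroup G] [Lattice G] [IsOrderedAddMonoid G] [LuGroup G]

/-- The inclusion `[0, u] ⊆ G`. -/
def val (x : Segment G) : G := Subtype.val x

lemma val_nonneg (x : Segment G) : 0 ≤ x.val := x.2.1

lemma val_le (x : Segment G) : x.val ≤ LuGroup.unit := x.2.2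

lemma val_injective : Function.Injective (val : Segment G → G) := Subtype.val_injective

/-- `x ⊕ y = u ∧ (x + y)`. -/
instance instAdd : Add (Segment G) where
  add x y := ⟨LuGroup.unit ⊓ (x.val + y.val),
    le_inf LuGroup.unit_nonneg (add_nonneg x.2.1 y.2.1), inf_le_left⟩

instance instZero : Zero (Segment G) where
  zero := ⟨0, le_rfl, LuGroup.unit_nonneg⟩

/-- `¬ x = u - x`. -/
instance instCompl : Compl (Segment G) where
  compl x := ⟨LuGroup.unit - x.val, sub_nonneg.2 x.2.2, sub_le_self _ x.2.1⟩

/-- The MV-algebra `Γ(G, u)`. -/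
instance instMVAlgebra : MVAlgebra (Segment G) where
  nsmul := nsmulRec
  add_assoc x y z := by
    apply val_injective
    change LuGroup.unit ⊓ (LuGroup.unit ⊓ (x.val + y.val) + z.val) =
      LuGroup.unit ⊓ (x.val + LuGroup.unit ⊓ (y.val + z.val))
    rw [add_aux z.val_nonneg, add_comm x.val (LuGroup.unit ⊓ _), add_aux x.val_nonneg]
    congr 1; abel
  zero_add x := by
    apply val_injective
    change LuGroup.unit ⊓ (0 + x.val) = x.val
    rw [zero_add]; exact inf_of_le_right x.val_le
  add_zero x := by
    apply val_injective
    change LuGroup.unit ⊓ (x.val + 0) = x.val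
    rw [add_zero]; exact inf_of_le_right x.val_le
  add_comm x y := by
    apply val_injective
    change LuGroup.unit ⊓ (x.val + y.val) = LuGroup.unit ⊓ (y.val + x.val)
    rw [add_comm]
  compl_invol x := by
    apply val_injective
    change LuGroup.unit - (LuGroup.unit - x.val) = x.val
    abel
  add_compl_zero x := by
    apply val_injective
    change LuGroup.unit ⊓ (x.val + (LuGroup.unit - 0)) = LuGroup.unit - 0
    rw [sub_zero]; exact inf_of_le_left (le_add_of_nonneg_left x.val_nonneg)
  luk x y := by
    apply val_injective
    change LuGroup.unit ⊓ (LuGroup.unit - LuGroup.unit ⊓ (LuGroup.unit - x.val + y.val) + y.val) =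
      LuGroup.unit ⊓ (LuGroup.unit - LuGroup.unit ⊓ (LuGroup.unit - y.val + x.val) + x.val)
    rw [luk_aux x.val_le y.val_le, luk_aux y.val_le x.val_le, sup_comm]

lemma val_zero : (0 : Segment G).val = 0 := rfl
lemma val_add (x y : Segment G) : (x + y).val = LuGroup.unit ⊓ (x.val + y.val) := rfl
lemma val_compl (x : Segment G) : xᶜ.val = LuGroup.unit - x.val := rfl

lemma val_one : (1 : Segment G).val = LuGroup.unit := by
  rw [one_def, val_compl, val_zero, sub_zero]

lemma le_iff {x y : Segment G} : x ≤ y ↔ x.val ≤ y.val := by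
  rw [le_def, ← val_injective.eq_iff, val_add, val_compl, val_one, inf_eq_left]
  rw [sub_add_eq_add_sub, le_sub_iff_add_le]
  exact add_le_add_iff_left _

lemma val_ominus (x y : Segment G) : (ominus x y).val = 0 ⊔ (x.val - y.val) := by
  rw [ominus, val_compl, val_add, val_compl, sub_inf, sub_self]
  congr 1; abel

end Segment

/-! ### l-ideals, their quotients, and prime l-ideals -/

/-- An l-ideal: a subgroup `J` such that `|y| ≤ |x|` and `x ∈ J` imply `y ∈ J`. -/
structure LIdeal (G : Type*) [AddCommGroup G] [Lattice G] extends AddSubgroup G where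
  solid : ∀ {x y : G}, x ∈ toAddSubgroup → |y| ≤ |x| → y ∈ toAddSubgroup

namespace LIdeal

section Quot

variable {G : Type*} [AddCommGroup G] [Lattice G] (J : LIdeal G)

/-- The quotient `G / J`. -/
def Quot : Type _ := G ⧸ J.toAddSubgroup

instance instAddCommGroup : AddCommGroup J.Quot :=
  inferInstanceAs (AddCommGroup (G ⧸ J.toAddSubgroup))

/-- The class `[x]_J`. -/
def cls (x : G) : J.Quot := QuotientAddGroup.mk x

lemma cls_eq_iff {x y : G} : J.cls x = J.cls y ↔ x - y ∈ J.toAddSubgroup :=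
  QuotientAddGroup.eq_iff_sub_mem

lemma cls_surjective : Function.Surjective J.cls := Quotient.exists_rep

lemma cls_zero : J.cls 0 = 0 := rfl
lemma cls_add (x y : G) : J.cls (x + y) = J.cls x + J.cls y := rfl
lemma cls_sub (x y : G) : J.cls (x - y) = J.cls x - J.cls y := rfl
lemma cls_nsmul (n : ℕ) (x : G) : J.cls (n • x) = n • J.cls x := rfl
lemma cls_zsmul (n : ℤ) (x : G) : J.cls (n • x) = n • J.cls x := rfl

variable [IsOrderedAddMonoid G]

lemma sup_congr {a b c d : G} (h1 : J.cls a = J.cls b) (h2 : J.cls c = J.cls d) :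
    J.cls (a ⊔ c) = J.cls (b ⊔ d) := by
  have key : ∀ {a b : G} (c : G), J.cls a = J.cls b → J.cls (a ⊔ c) = J.cls (b ⊔ c) := by
    intro a b c h
    rw [cls_eq_iff] at h ⊢
    exact J.solid h (abs_sup_sub_sup_le_abs a b c)
  rw [key c h1, sup_comm b c, key b h2, sup_comm d b]

lemma inf_congr {a b c d : G} (h1 : J.cls a = J.cls b) (h2 : J.cls c = J.cls d) :
    J.cls (a ⊓ c) = J.cls (b ⊓ d) := by
  have key : ∀ {a b : G} (c : G), J.cls a = J.cls b → J.cls (a ⊓ c) = J.cls (b ⊓ c) := by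
    intro a b c h
    rw [cls_eq_iff] at h ⊢
    exact J.solid h (abs_inf_sub_inf_le_abs a b c)
  rw [key c h1, inf_comm b c, key b h2, inf_comm d b]

/-- The join of classes. -/
def sup : J.Quot → J.Quot → J.Quot :=
  Quotient.map₂ (· ⊔ ·) fun _ _ h1 _ _ h2 =>
    Quotient.exact (J.sup_congr (Quotient.sound h1) (Quotient.sound h2))

/-- The meet of classes. -/
def inf : J.Quot → J.Quot → J.Quot :=
  Quotient.map₂ (· ⊓ ·) fun _ _ h1 _ _ h2 =>
    Quotient.exact (J.inf_congr (Quotient.sound h1) (Quotient.sound h2))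

/-- The lattice structure of `G / J`, with the operations of representatives. -/
instance instLattice : Lattice J.Quot :=
  @Lattice.mk' _ ⟨J.sup⟩ ⟨J.inf⟩
    (by rintro ⟨a⟩ ⟨b⟩; exact congrArg J.cls (sup_comm a b))
    (by rintro ⟨a⟩ ⟨b⟩ ⟨c⟩; exact congrArg J.cls (sup_assoc a b c))
    (by rintro ⟨a⟩ ⟨b⟩; exact congrArg J.cls (inf_comm a b))
    (by rintro ⟨a⟩ ⟨b⟩ ⟨c⟩; exact congrArg J.cls (inf_assoc a b c))
    (by rintro ⟨a⟩ ⟨b⟩; exact congrArg J.cls (sup_inf_self (a := a) (b := b)))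
    (by rintro ⟨a⟩ ⟨b⟩; exact congrArg J.cls (inf_sup_self (a := a) (b := b)))

lemma cls_sup (x y : G) : J.cls (x ⊔ y) = J.cls x ⊔ J.cls y := rfl
lemma cls_inf (x y : G) : J.cls (x ⊓ y) = J.cls x ⊓ J.cls y := rfl

lemma cls_mono {x y : G} (h : x ≤ y) : J.cls x ≤ J.cls y := by
  rw [← sup_eq_right, ← cls_sup, sup_of_le_right h]

instance instIsOrderedAddMonoid : IsOrderedAddMonoid J.Quot where
  add_le_add_left := by
    intro a b h c
    obtain ⟨x, rfl⟩ := J.cls_surjective a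
    obtain ⟨y, rfl⟩ := J.cls_surjective b
    obtain ⟨z, rfl⟩ := J.cls_surjective c
    rw [← sup_eq_right, ← cls_sup] at h
    rw [← sup_eq_right, ← cls_add, ← cls_add, ← cls_sup, ← sup_add, cls_add, h, cls_add]

/-- `G / J` with the strong unit `u_J = [u]_J`. -/
instance instLuGroup [LuGroup G] : LuGroup J.Quot where
  unit := J.cls LuGroup.unit
  unit_nonneg := J.cls_mono LuGroup.unit_nonneg
  exists_abs_le a := by
    obtain ⟨x, rfl⟩ := J.cls_surjective a
    obtain ⟨n, hn⟩ := LuGroup.exists_abs_le x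
    exact ⟨n, J.cls_mono hn⟩

lemma cls_unit [LuGroup G] : J.cls LuGroup.unit = LuGroup.unit := rfl

end Quot

end LIdeal

/-- Prime l-ideals: proper, and `x ∧ y = 0` implies `x ∈ P` or `y ∈ P`. -/
structure PrimeLIdeal (G : Type*) [AddCommGroup G] [Lattice G] extends LIdeal G where
  ne_top : toAddSubgroup ≠ ⊤
  prime : ∀ x y : G, x ⊓ y = 0 → x ∈ toAddSubgroup ∨ y ∈ toAddSubgroup

namespace PrimeLIdeal

variable {G : Type*} [AddCommGroup G] [Lattice G] [IsOrderedAddMonoid G]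

lemma pos_mem (P : PrimeLIdeal G) (x y : G) :
    0 ⊔ (x - y) ∈ P.toAddSubgroup ∨ 0 ⊔ (y - x) ∈ P.toAddSubgroup := by
  apply P.prime
  rw [← neg_sub x y, sup_comm, sup_comm 0]
  exact posPart_inf_negPart_eq_zero (x - y)

variable [LuGroup G] (P : PrimeLIdeal G)

lemma unit_not_mem : (LuGroup.unit : G) ∉ P.toAddSubgroup := by
  intro h
  apply P.ne_top
  rw [eq_top_iff]
  intro x _
  obtain ⟨n, hn⟩ := LuGroup.exists_abs_le x
  exact P.solid (P.toAddSubgroup.nsmul_mem h n) (hn.trans (le_abs_self _))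

/-- The prime ideal `P ∩ [0, u]` of `Γ(G, u)`. -/
def trace : PrimeMVIdeal (Segment G) where
  carrier := {x | x.val ∈ P.toAddSubgroup}
  zero_mem := P.toAddSubgroup.zero_mem
  add_mem := by
    intro a b ha hb
    refine P.solid (P.toAddSubgroup.add_mem ha hb) ?_
    rw [abs_of_nonneg (a + b).val_nonneg, abs_of_nonneg (add_nonneg a.val_nonneg b.val_nonneg)]
    exact inf_le_right
  mem_of_le := by
    intro a b hb hab
    refine P.solid hb ?_
    rw [abs_of_nonneg a.val_nonneg, abs_of_nonneg b.val_nonneg]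
    exact Segment.le_iff.1 hab
  ne_univ h := by
    have : (1 : Segment G) ∈ {x : Segment G | x.val ∈ P.toAddSubgroup} := by
      rw [h]; trivial
    rw [Set.mem_ofPred_eq, Segment.val_one] at this
    exact P.unit_not_mem this
  prime a b := by
    rw [Set.mem_ofPred_eq, Set.mem_ofPred_eq, Segment.val_ominus, Segment.val_ominus]
    exact P.pos_mem a.val b.val

instance instMVChain : MVChain (Segment P.toLIdeal.Quot) where
  total a b := by
    obtain ⟨x, hx⟩ := P.toLIdeal.cls_surjective a.val
    obtain ⟨y, hy⟩ := P.toLIdeal.cls_surjective b.val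
    rw [Segment.le_iff, Segment.le_iff, ← hx, ← hy]
    have key : ∀ x y : G, 0 ⊔ (x - y) ∈ P.toAddSubgroup →
        P.toLIdeal.cls x ≤ P.toLIdeal.cls y := by
      intro x y h
      have h' : P.toLIdeal.cls (0 ⊔ (x - y)) = P.toLIdeal.cls 0 := by
        rw [LIdeal.cls_eq_iff, sub_zero]; exact h
      rw [LIdeal.cls_sup, LIdeal.cls_zero, sup_eq_left, LIdeal.cls_sub, sub_nonpos] at h'
      exact h'
    exact (P.pos_mem x y).imp (key x y) (key y x)

instance instNontrivial : Nontrivial (Segment P.toLIdeal.Quot) := by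
  refine ⟨⟨1, 0, fun h => P.unit_not_mem ?_⟩⟩
  have h' := congrArg Segment.val h
  rw [Segment.val_one, Segment.val_zero, ← LIdeal.cls_unit, ← LIdeal.cls_zero,
    LIdeal.cls_eq_iff, sub_zero] at h'
  exact h'

/-- The canonical morphism `Γ(G,u)/(P ∩ [0,u]) → Γ(G/P, u_P)`, `[x]_{P ∩ [0,u]} ↦ [x]_P`. -/
def segmentHom : MVHom P.trace.toMVIdeal.Quot (Segment P.toLIdeal.Quot) where
  toFun := Quotient.lift (s := P.trace.toMVIdeal.setoid)
    (fun x : Segment G => (⟨P.toLIdeal.cls x.val, P.toLIdeal.cls_mono x.val_nonneg,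
      P.toLIdeal.cls_mono x.val_le⟩ : Segment P.toLIdeal.Quot)) (by
    intro x y h
    apply Segment.val_injective
    change P.toLIdeal.cls x.val = P.toLIdeal.cls y.val
    rw [LIdeal.cls_eq_iff]
    have h1 : (ominus x y).val ∈ P.toAddSubgroup := h.1
    have h2 : (ominus y x).val ∈ P.toAddSubgroup := h.2
    rw [Segment.val_ominus] at h1 h2
    have h3 := P.toAddSubgroup.sub_mem h1 h2
    have e : (0 ⊔ (x.val - y.val)) - (0 ⊔ (y.val - x.val)) = x.val - y.val := by
      have : 0 ⊔ (x.val - y.val) = (0 ⊔ (y.val - x.val)) + (x.val - y.val) := by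
        rw [sup_add, zero_add, sub_add_sub_cancel, sub_self, sup_comm]
      rw [this]; abel
    rwa [e] at h3)
  map_zero := rfl
  map_add := by rintro ⟨x⟩ ⟨y⟩; rfl
  map_compl := by rintro ⟨x⟩; rfl

end PrimeLIdeal

/-! ## The maps `υ` -/

section Upsilon

/-- Chang's map `υ : Γ(G,u)^* → G`, `υ(m, a) = m u + a`, on a single fiber. -/
def Chang.upsilon {G : Type*} [AddCommGroup G] [Lattice G] [IsOrderedAddMonoid G] [LuGroup G]
    [Nontrivial (Segment G)] : Chang (Segment G) → G :=
  Chang.lift (fun m a => m • (LuGroup.unit : G) + a.val) (fun m => by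
    rw [Segment.val_one, Segment.val_zero, add_zero, add_zsmul, one_zsmul])

variable {G : Type*} [AddCommGroup G] [Lattice G] [IsOrderedAddMonoid G] [LuGroup G]

/-- The section `x̂` of `∏_{P ∈ Sp(G)} G/P`, with `x̂(P) = [x]_P`. -/
def hatG (x : G) : ∀ P : PrimeLIdeal G, P.toLIdeal.Quot := fun P => P.toLIdeal.cls x

/-- The composite
`∏_{Q ∈ Sp(Γ(G,u))} (Γ(G,u)/Q)^* → ∏_{P ∈ Sp(G)} (Γ(G,u)/(P ∩ [0,u]))^* →
∏_{P ∈ Sp(G)} Γ(G/P,u_P)^* → ∏_{P ∈ Sp(G)} G/P`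
of reindexing along `P ↦ P ∩ [0,u]`, the maps induced by the canonical morphisms
`Γ(G,u)/(P ∩ [0,u]) → Γ(G/P,u_P)`, and Chang's maps `υ` on the fibers. -/
def upsilonProd (σ : StarProd (Segment G)) : ∀ P : PrimeLIdeal G, P.toLIdeal.Quot :=
  fun P => Chang.upsilon (Chang.map P.segmentHom (σ P.trace))

end Upsilon

/-! ## l-subgroups with strong unit, and unital l-homomorphisms -/

/-- The subgroup `S` of the lattice-ordered group `H` is closed under the lattice operations of
`H`, and `v` is an element of `S` that is a strong unit of `S`. -/
structure IsLuSubgroup {H : Type*} [AddCommGroup H] [Lattice H] (S : AddSubgroup H) (v : H) :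
    Prop where
  sup_mem : ∀ x ∈ S, ∀ y ∈ S, x ⊔ y ∈ S
  inf_mem : ∀ x ∈ S, ∀ y ∈ S, x ⊓ y ∈ S
  unit_mem : v ∈ S
  unit_nonneg : 0 ≤ v
  exists_abs_le : ∀ x ∈ S, ∃ n : ℕ, |x| ≤ n • v

/-- The lattice structure that such a subgroup inherits. -/
abbrev IsLuSubgroup.lattice {H : Type*} [AddCommGroup H] [Lattice H] {S : AddSubgroup H} {v : H}
    (h : IsLuSubgroup S v) : Lattice S :=
  Subtype.lattice (P := fun x => x ∈ S) (fun {x y} hx hy => h.sup_mem x hx y hy)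
    (fun {x y} hx hy => h.inf_mem x hx y hy)

/-- `f` is an isomorphism of abelian l-groups `H → K` that maps the distinguished element `v`
to `w`. -/
structure IsUnitalLIso {H K : Type*} [AddCommGroup H] [Lattice H] [AddCommGroup K] [Lattice K]
    (v : H) (w : K) (f : H → K) : Prop where
  map_add : ∀ x y, f (x + y) = f x + f y
  map_sup : ∀ x y, f (x ⊔ y) = f x ⊔ f y
  map_inf : ∀ x y, f (x ⊓ y) = f x ⊓ f y
  map_unit : f v = w
  bijective : Function.Bijective f

/-! Three facts make the product map an isomorphism. First, `P ↦ P ∩ [0,u]` is a bijection between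
the prime spectra, with inverse `Q ↦ {x | u ∧ |x| ∈ Q}` (`trace_injective`, `trace_untrace`).
Second, `Γ(G,u)/(P ∩ [0,u]) → Γ(G/P,u_P)` is bijective (`segmentHom_injective`,
`segmentHom_surjective`). Third, Chang's map is an isomorphism for a totally ordered group with
strong unit (`upsilon_add`, `upsilon_injective`, `upsilon_surjective`), because every element is an
integer multiple of the unit plus a remainder in the segment.

For the restriction, each `ι x̂` goes to the diagonal section `x̂`, and `[0,u]` generates `G`
(`closure_range_val`). So `υ` carries the generated subgroup `Γ(G,u)^*` exactly onto the diagonal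
copy of `G` (`map_mvStar`). Prime l-ideals separate points (`exists_primeLIdeal_not_mem`), so that
copy is faithful. The lattice operations and the strong unit are then pulled back from it, and
identities in `G`, including uniqueness, are checked in the quotients `G/P`. -/

/-! ### Meets of positive elements with sums and multiples. -/

section LatticeOrderedGroup

variable {G : Type*} [AddCommGroup G] [Lattice G] [IsOrderedAddMonoid G]

/-- The right side expands to the meet of `a + a`, `a + c`, `b + a` and `b + c`. The first three lie
above `a`, and the last is `b + c`. -/
lemma inf_add_le_inf_add_inf {a b c : G} (ha : 0 ≤ a) (hb : 0 ≤ b) (hc : 0 ≤ c) :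
    a ⊓ (b + c) ≤ a ⊓ b + a ⊓ c := by
  rw [inf_add, add_inf, add_inf]
  exact le_inf (le_inf (inf_le_left.trans (le_add_of_nonneg_left ha))
      (inf_le_left.trans (le_add_of_nonneg_right hc)))
    (le_inf (inf_le_left.trans (le_add_of_nonneg_left hb)) inf_le_right)

lemma inf_nsmul_le_nsmul_inf {a b : G} (ha : 0 ≤ a) (hb : 0 ≤ b) (n : ℕ) :
    a ⊓ n • b ≤ n • (a ⊓ b) := by
  induction n with
  | zero => rw [zero_nsmul, zero_nsmul]; exact inf_le_right
  | succ n ih =>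
    rw [succ_nsmul, succ_nsmul]
    exact (inf_add_le_inf_add_inf ha (nsmul_nonneg hb n) hb).trans (by gcongr)

lemma nsmul_inf_nsmul_eq_zero {a b : G} (h : a ⊓ b = 0) (m n : ℕ) : m • a ⊓ n • b = 0 := by
  have ha : 0 ≤ a := h ▸ inf_le_left
  have hb : 0 ≤ b := h ▸ inf_le_right
  have step : ∀ {x y : G} (k : ℕ), 0 ≤ x → 0 ≤ y → x ⊓ y = 0 → x ⊓ k • y = 0 := by
    intro x y k hx hy hxy
    refine le_antisymm ?_ (le_inf hx (nsmul_nonneg hy k))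
    have := inf_nsmul_le_nsmul_inf hx hy k
    rwa [hxy, nsmul_zero] at this
  have h1 := step n ha hb h
  rw [inf_comm] at h1 ⊢
  exact step m (nsmul_nonneg hb n) ha h1

end LatticeOrderedGroup

/-! ### Prime l-ideals separate points -/

namespace LIdeal

variable {G : Type*} [AddCommGroup G] [Lattice G]

lemma mem_of_abs_le (J : LIdeal G) {x y : G} (hx : x ∈ J.toAddSubgroup) (h : |y| ≤ x) :
    y ∈ J.toAddSubgroup :=
  J.solid hx (h.trans (le_abs_self x))

variable [IsOrderedAddMonoid G]

lemma abs_mem (J : LIdeal G) {x : G} (hx : x ∈ J.toAddSubgroup) : |x| ∈ J.toAddSubgroup :=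
  J.solid hx (abs_abs x).le

/-- The l-ideal generated by `J` and an element `a ≥ 0`. -/
def adjoin (J : LIdeal G) (a : G) : LIdeal G where
  -- Membership depends only on `|y|` and is downward closed in it, so solidity is automatic. No
  -- sign is imposed on `p`.
  carrier := {y | ∃ p ∈ J.toAddSubgroup, ∃ n : ℕ, |y| ≤ p + n • a}
  zero_mem' := ⟨0, J.toAddSubgroup.zero_mem, 0, by simp⟩
  add_mem' := by
    rintro x y ⟨p, hp, n, hx⟩ ⟨q, hq, m, hy⟩
    refine ⟨p + q, J.toAddSubgroup.add_mem hp hq, n + m, (abs_add_le x y).trans ?_⟩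
    refine (add_le_add hx hy).trans (le_of_eq ?_)
    rw [add_nsmul]; abel
  neg_mem' := by
    rintro x ⟨p, hp, n, hx⟩
    exact ⟨p, hp, n, by rwa [abs_neg]⟩
  solid := by
    rintro x y ⟨p, hp, n, hx⟩ h
    exact ⟨p, hp, n, h.trans hx⟩

lemma le_adjoin (J : LIdeal G) (a : G) :
    J.toAddSubgroup ≤ (J.adjoin a).toAddSubgroup := fun x hx =>
  ⟨|x|, J.abs_mem hx, 0, by simp⟩

lemma self_mem_adjoin (J : LIdeal G) {a : G} (ha : 0 ≤ a) :
    a ∈ (J.adjoin a).toAddSubgroup :=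
  ⟨0, J.toAddSubgroup.zero_mem, 1, by simp [abs_of_nonneg ha]⟩

/-- With `c = |p| + |q|` as a common bound from `J`, `|x| ≤ (c + n a) ∧ (c + m b) = c + (n a ∧ m b)
= c`. This is what makes a maximal l-ideal avoiding a point prime. -/
lemma mem_of_mem_adjoin_of_inf_eq_zero (J : LIdeal G) {a b x : G}
    (hab : a ⊓ b = 0) (hxa : x ∈ (J.adjoin a).toAddSubgroup)
    (hxb : x ∈ (J.adjoin b).toAddSubgroup) : x ∈ J.toAddSubgroup := by
  obtain ⟨p, hp, n, hx⟩ := hxa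
  obtain ⟨q, hq, m, hy⟩ := hxb
  refine J.mem_of_abs_le (J.toAddSubgroup.add_mem (J.abs_mem hp) (J.abs_mem hq)) ?_
  have h1 : |x| ≤ |p| + |q| + n • a :=
    hx.trans (add_le_add ((le_abs_self p).trans (le_add_of_nonneg_right (abs_nonneg q))) le_rfl)
  have h2 : |x| ≤ |p| + |q| + m • b :=
    hy.trans (add_le_add ((le_abs_self q).trans (le_add_of_nonneg_left (abs_nonneg p))) le_rfl)
  have h := le_inf h1 h2
  rwa [← add_inf, nsmul_inf_nsmul_eq_zero hab, add_zero] at h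

end LIdeal

section Separation

variable {G : Type*} [AddCommGroup G] [Lattice G] [IsOrderedAddMonoid G]

/-- An l-ideal `M` maximal among those avoiding `x` is prime: if `a ∧ b = 0` with neither in `M`,
then `x` lies in both enlargements of `M`, hence in `M`. -/
lemma exists_primeLIdeal_not_mem {x : G} (hx : x ≠ 0) :
    ∃ P : PrimeLIdeal G, x ∉ P.toAddSubgroup := by
  let S : Set (AddSubgroup G) :=
    {H | (∀ {a b : G}, a ∈ H → |b| ≤ |a| → b ∈ H) ∧ x ∉ H}
  have hbot : (⊥ : AddSubgroup G) ∈ S := by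
    refine ⟨fun {a b} ha h => ?_, by simpa using hx⟩
    rw [AddSubgroup.mem_bot] at ha ⊢
    rw [ha, abs_zero] at h
    exact le_antisymm ((le_abs_self b).trans h) (neg_nonpos.1 ((neg_le_abs b).trans h))
  obtain ⟨M, -, hM⟩ := zorn_le_nonempty₀ S (fun c hc hchain y hy => by
    have hne : c.Nonempty := ⟨y, hy⟩
    -- A chain is directed, so its supremum is the union; solidity and avoidance of `x` are
    -- inherited from a single member.
    refine ⟨sSup c, ⟨fun {a b} ha h => ?_, fun h => ?_⟩, fun z hz => le_sSup hz⟩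
    · rw [AddSubgroup.mem_sSup_of_directedOn hne hchain.directedOn] at ha ⊢
      obtain ⟨H, hH, haH⟩ := ha
      exact ⟨H, hH, (hc hH).1 haH h⟩
    · rw [AddSubgroup.mem_sSup_of_directedOn hne hchain.directedOn] at h
      obtain ⟨H, hH, hxH⟩ := h
      exact (hc hH).2 hxH) ⊥ hbot
  let J : LIdeal G := ⟨M, hM.prop.1⟩
  have key : ∀ (a : G) (ha : 0 ≤ a), a ∉ M → x ∈ (J.adjoin a).toAddSubgroup := by
    intro a ha haM
    by_contra hxa
    exact haM (hM.le_of_ge ⟨(J.adjoin a).solid, hxa⟩ (J.le_adjoin a)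
      (J.self_mem_adjoin ha))
  refine ⟨⟨J, fun h => hM.prop.2 ?_, fun a b hab => ?_⟩, hM.prop.2⟩
  · change M = ⊤ at h
    rw [h]; trivial
  · by_contra! h
    have ha : 0 ≤ a := hab ▸ inf_le_left
    have hb : 0 ≤ b := hab ▸ inf_le_right
    exact hM.prop.2 (J.mem_of_mem_adjoin_of_inf_eq_zero hab (key a ha h.1) (key b hb h.2))

lemma hatG_injective : Function.Injective (hatG : G → ∀ P : PrimeLIdeal G, P.toLIdeal.Quot) := by
  intro x y h
  by_contra hne
  obtain ⟨P, hP⟩ := exists_primeLIdeal_not_mem (sub_ne_zero.2 hne)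
  exact hP (P.toLIdeal.cls_eq_iff.1 (congrFun h P))

end Separation

/-! ### Prime ideals of `G` and of its unit segment -/

namespace Segment

variable {G : Type*} [AddCommGroup G] [Lattice G] [IsOrderedAddMonoid G] [LuGroup G]

/-- The element `u ∧ |x|` of the segment. -/
def truncAbs (x : G) : Segment G :=
  ⟨LuGroup.unit ⊓ |x|, le_inf LuGroup.unit_nonneg (abs_nonneg x), inf_le_left⟩

lemma val_truncAbs (x : G) : (truncAbs x).val = LuGroup.unit ⊓ |x| := rfl

lemma truncAbs_val (x : Segment G) : truncAbs x.val = x := by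
  apply val_injective
  rw [val_truncAbs, abs_of_nonneg x.val_nonneg, inf_of_le_right x.val_le]

lemma truncAbs_mono {x y : G} (h : |x| ≤ |y|) : truncAbs x ≤ truncAbs y :=
  le_iff.2 (inf_le_inf_left _ h)

/-- This subadditivity makes `{x | u ∧ |x| ∈ Q}` closed under addition. -/
lemma truncAbs_add_le (x y : G) : truncAbs (x + y) ≤ truncAbs x + truncAbs y := by
  rw [le_iff, val_add]
  refine le_inf (truncAbs (x + y)).val_le ?_
  exact (inf_le_inf_left _ (abs_add_le x y)).trans
    (inf_add_le_inf_add_inf LuGroup.unit_nonneg (abs_nonneg x) (abs_nonneg y))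

lemma truncAbs_unit : truncAbs (LuGroup.unit : G) = 1 := by
  rw [← val_one, truncAbs_val]

/-- In the segment `s ⊖ t = s - s ∧ t`, and truncations of disjoint elements are disjoint. Hence
primality of an MV-ideal yields primality of the corresponding l-ideal. -/
lemma ominus_truncAbs {x y : G} (h : x ⊓ y = 0) :
    ominus (truncAbs x) (truncAbs y) = truncAbs x := by
  apply val_injective
  have hx : 0 ≤ x := h ▸ inf_le_left
  have hy : 0 ≤ y := h ▸ inf_le_right
  have h0 : (truncAbs x).val ⊓ (truncAbs y).val = 0 := by
    rw [val_truncAbs, val_truncAbs, abs_of_nonneg hx, abs_of_nonneg hy, ← inf_inf_distrib_left, h]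
    exact inf_of_le_right LuGroup.unit_nonneg
  rw [val_ominus, ← sub_self (truncAbs x).val, ← sub_inf, h0, sub_zero]

/-- If `|x| ≤ n u`, then `|x| = |x| ∧ n u ≤ n (|x| ∧ u)`. Thus an l-ideal containing `u ∧ |x|`
contains `x`. -/
lemma abs_le_nsmul_truncAbs (x : G) : ∃ n : ℕ, |x| ≤ n • (truncAbs x).val := by
  obtain ⟨n, hn⟩ := LuGroup.exists_abs_le x
  refine ⟨n, ?_⟩
  have h := inf_nsmul_le_nsmul_inf (abs_nonneg x) LuGroup.unit_nonneg n
  rwa [inf_of_le_left hn, inf_comm] at h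

/-- A positive element below `(n + 1) u` loses the piece `x ∧ u`, which lies in the segment; the
rest, `0 ∨ (x - u)`, is below `n u`. -/
lemma closure_range_val : AddSubgroup.closure (Set.range (val : Segment G → G)) = ⊤ := by
  set H := AddSubgroup.closure (Set.range (val : Segment G → G))
  have key : ∀ (n : ℕ) (x : G), 0 ≤ x → x ≤ n • LuGroup.unit → x ∈ H := by
    intro n
    induction n with
    | zero =>
      intro x h0 h1
      rw [zero_nsmul] at h1
      rw [le_antisymm h1 h0]
      exact H.zero_mem
    | succ n ih =>
      intro x h0 h1
      have e : x = x ⊓ LuGroup.unit + (x - x ⊓ LuGroup.unit) := by abel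
      rw [e]
      refine H.add_mem (AddSubgroup.subset_closure
        ⟨⟨x ⊓ LuGroup.unit, le_inf h0 LuGroup.unit_nonneg, inf_le_right⟩, rfl⟩)
        (ih _ (sub_nonneg.2 inf_le_left) ?_)
      rw [sub_inf, sub_self]
      refine sup_le (nsmul_nonneg LuGroup.unit_nonneg n) ?_
      rw [sub_le_iff_le_add, ← succ_nsmul]
      exact h1
  rw [eq_top_iff]
  intro x _
  obtain ⟨n, hn⟩ := LuGroup.exists_abs_le x
  -- Both terms are positive, and the second is at most `2 n u` because `-x ≤ |x|`.
  have e : x = |x| - (|x| - x) := by abel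
  rw [e]
  refine H.sub_mem (key n _ (abs_nonneg x) hn)
    (key (n + n) _ (sub_nonneg.2 (le_abs_self x)) ?_)
  rw [add_nsmul, sub_eq_add_neg]
  exact add_le_add hn ((neg_le_abs x).trans hn)

end Segment

/-- The prime l-ideal `{x | u ∧ |x| ∈ Q}` of `G`. -/
def PrimeMVIdeal.untrace {G : Type*} [AddCommGroup G] [Lattice G] [IsOrderedAddMonoid G]
    [LuGroup G] (Q : PrimeMVIdeal (Segment G)) : PrimeLIdeal G where
  carrier := {x | Segment.truncAbs x ∈ Q.carrier}
  zero_mem' := by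
    change Segment.truncAbs (0 : G) ∈ Q.carrier
    rw [← Segment.val_zero, Segment.truncAbs_val]
    exact Q.zero_mem
  add_mem' {x y} hx hy := Q.mem_of_le (Q.add_mem hx hy) (Segment.truncAbs_add_le x y)
  neg_mem' {x} hx := Q.mem_of_le hx (Segment.truncAbs_mono (abs_neg x).le)
  solid {x y} hx h := Q.mem_of_le hx (Segment.truncAbs_mono h)
  ne_top h := by
    have h1 : (LuGroup.unit : G) ∈ (⊤ : AddSubgroup G) := trivial
    rw [← h] at h1
    change Segment.truncAbs (LuGroup.unit : G) ∈ Q.carrier at h1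
    rw [Segment.truncAbs_unit] at h1
    exact Q.ne_univ (Set.eq_univ_of_forall fun a => Q.mem_of_le h1 (le_one' a))
  prime x y h := by
    change Segment.truncAbs x ∈ Q.carrier ∨ Segment.truncAbs y ∈ Q.carrier
    have := Q.prime (Segment.truncAbs x) (Segment.truncAbs y)
    rwa [Segment.ominus_truncAbs h, Segment.ominus_truncAbs (inf_comm x y ▸ h)] at this

namespace PrimeLIdeal

variable {G : Type*} [AddCommGroup G] [Lattice G] [IsOrderedAddMonoid G]

/-- The positive parts of `x - y` and `y - x` are disjoint, so one of them vanishes modulo `P`.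
Chang's map needs this for the whole quotient, not just its segment. -/
lemma quot_total (P : PrimeLIdeal G) (a b : P.toLIdeal.Quot) : a ≤ b ∨ b ≤ a := by
  obtain ⟨x, rfl⟩ := P.toLIdeal.cls_surjective a
  obtain ⟨y, rfl⟩ := P.toLIdeal.cls_surjective b
  have key : ∀ x y : G, 0 ⊔ (x - y) ∈ P.toAddSubgroup →
      P.toLIdeal.cls x ≤ P.toLIdeal.cls y := by
    intro x y h
    have h' : P.toLIdeal.cls (0 ⊔ (x - y)) = P.toLIdeal.cls 0 := by
      rw [LIdeal.cls_eq_iff, sub_zero]; exact h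
    rw [LIdeal.cls_sup, LIdeal.cls_zero, sup_eq_left, LIdeal.cls_sub, sub_nonpos] at h'
    exact h'
  exact (P.pos_mem x y).imp (key x y) (key y x)

variable [LuGroup G]

lemma mem_trace {P : PrimeLIdeal G} {x : Segment G} :
    x ∈ P.trace.carrier ↔ x.val ∈ P.toAddSubgroup := Iff.rfl

/-- A prime l-ideal is thereby recovered from its trace. -/
lemma truncAbs_mem_trace {P : PrimeLIdeal G} {x : G} :
    Segment.truncAbs x ∈ P.trace.carrier ↔ x ∈ P.toAddSubgroup := by
  rw [mem_trace]
  constructor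
  · intro h
    obtain ⟨n, hn⟩ := Segment.abs_le_nsmul_truncAbs x
    exact P.mem_of_abs_le (P.toAddSubgroup.nsmul_mem h n) hn
  · intro h
    refine P.solid h ?_
    rw [abs_of_nonneg (Segment.truncAbs x).val_nonneg]
    exact inf_le_right

lemma trace_injective : Function.Injective (trace : PrimeLIdeal G → PrimeMVIdeal (Segment G)) := by
  intro P P' h
  have h1 : P.toAddSubgroup = P'.toAddSubgroup := by
    ext x
    rw [← truncAbs_mem_trace, h, truncAbs_mem_trace]
  obtain ⟨⟨H, _⟩, _, _⟩ := P
  obtain ⟨⟨H', _⟩, _, _⟩ := P'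
  obtain rfl : H = H' := h1
  rfl

lemma trace_untrace (Q : PrimeMVIdeal (Segment G)) : Q.untrace.trace = Q := by
  have h1 : Q.untrace.trace.carrier = Q.carrier := by
    ext x
    change Segment.truncAbs x.val ∈ Q.carrier ↔ _
    rw [Segment.truncAbs_val]
  generalize Q.untrace.trace = Q' at h1
  obtain ⟨⟨c, _, _, _⟩, _, _⟩ := Q
  obtain ⟨⟨c', _, _, _⟩, _, _⟩ := Q'
  obtain rfl : c' = c := h1
  rfl

lemma segmentHom_injective (P : PrimeLIdeal G) : Function.Injective P.segmentHom.toFun := by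
  rintro ⟨x⟩ ⟨y⟩ h
  have h' : P.toLIdeal.cls x.val = P.toLIdeal.cls y.val := congrArg Segment.val h
  refine P.trace.toMVIdeal.cls_eq_iff.2 ⟨?_, ?_⟩
  · rw [mem_trace, Segment.val_ominus, ← sub_zero (0 ⊔ _), ← LIdeal.cls_eq_iff, LIdeal.cls_sup,
      LIdeal.cls_sub, h', sub_self, LIdeal.cls_zero, sup_idem]
  · rw [mem_trace, Segment.val_ominus, ← sub_zero (0 ⊔ _), ← LIdeal.cls_eq_iff, LIdeal.cls_sup,
      LIdeal.cls_sub, h', sub_self, LIdeal.cls_zero, sup_idem]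

lemma segmentHom_surjective (P : PrimeLIdeal G) : Function.Surjective P.segmentHom.toFun := by
  intro a
  obtain ⟨x, hx⟩ := P.toLIdeal.cls_surjective a.val
  -- An arbitrary representative is truncated into `[0,u]`; its class does not move, since it
  -- already lies between `0` and `u_P`.
  refine ⟨P.trace.toMVIdeal.cls (⟨0 ⊔ (x ⊓ LuGroup.unit), le_sup_left,
    sup_le LuGroup.unit_nonneg inf_le_right⟩ : Segment G), Segment.val_injective ?_⟩
  change P.toLIdeal.cls (0 ⊔ (x ⊓ LuGroup.unit)) = _
  rw [LIdeal.cls_sup, LIdeal.cls_inf, hx, LIdeal.cls_zero, LIdeal.cls_unit,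
    inf_of_le_left a.val_le, sup_of_le_right a.val_nonneg]

end PrimeLIdeal

/-! ### Chang's construction on morphisms and on segments -/

namespace Chang

/-! ### Functoriality of Chang's construction. -/

section Map

variable {A B : Type*} [MVAlgebra A] [Nontrivial A] [MVAlgebra B] [Nontrivial B]

lemma map_mk (h : MVHom A B) (m : ℤ) (a : A) : map h (mk m a) = mk m (h.toFun a) := rfl

lemma map_monotone [MVChain A] [MVChain B] (h : MVHom A B) : Monotone (map h) := by
  rintro x y ⟨m, a, n, b, rfl, rfl, hle⟩
  refine ⟨m, h.toFun a, n, h.toFun b, rfl, rfl, hle.imp_right fun hab => ⟨hab.1, ?_⟩⟩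
  rw [le_def, ← h.map_compl, ← h.map_add, le_def.1 hab.2, h.map_one]

lemma map_add (h : MVHom A B) (hinj : Function.Injective h.toFun) (x y : Chang A) :
    map h (x + y) = map h x + map h y := by
  obtain ⟨m, a, rfl⟩ := exists_rep x
  obtain ⟨n, b, rfl⟩ := exists_rep y
  by_cases hab : a + b = 1
  · have hab' : h.toFun a + h.toFun b = 1 := by rw [← h.map_add, hab, h.map_one]
    rw [mk_add_mk_of_eq hab, map_mk, map_mk, map_mk, mk_add_mk_of_eq hab', odot, odot,
      h.map_compl, h.map_add, h.map_compl, h.map_compl]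
  -- Injectivity keeps the image sum in the same branch, without carry.
  · have hab' : h.toFun a + h.toFun b ≠ 1 := by
      rw [← h.map_add, ← h.map_one]
      exact hinj.ne hab
    rw [mk_add_mk_of_ne hab, map_mk, map_mk, map_mk, mk_add_mk_of_ne hab', h.map_add]

/-- It suffices to reflect the order, and each clause of `mk_le_mk` is an equation in `A` that an
injective homomorphism reflects. -/
lemma map_injective [MVChain A] [MVChain B] (h : MVHom A B) (hinj : Function.Injective h.toFun) :
    Function.Injective (map h) := by
  have key : ∀ x y : Chang A, map h x ≤ map h y → x ≤ y := by
    intro x y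
    obtain ⟨m, a, rfl⟩ := exists_rep x
    obtain ⟨n, b, rfl⟩ := exists_rep y
    rw [map_mk, map_mk, mk_le_mk, mk_le_mk]
    rintro (hlt | ⟨rfl, hab⟩ | ⟨rfl, ha, hb⟩)
    · exact Or.inl hlt
    · refine Or.inr (Or.inl ⟨rfl, hinj ?_⟩)
      rw [h.map_add, h.map_compl, h.map_one, ← le_def]
      exact hab
    · exact Or.inr (Or.inr ⟨rfl, hinj (ha.trans h.map_zero.symm), hinj (hb.trans h.map_one.symm)⟩)
  exact fun x y hxy => le_antisymm (key x y hxy.le) (key y x hxy.ge)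

lemma map_surjective (h : MVHom A B) (hsurj : Function.Surjective h.toFun) :
    Function.Surjective (map h) := by
  intro y
  obtain ⟨m, b, rfl⟩ := exists_rep y
  obtain ⟨a, rfl⟩ := hsurj b
  exact ⟨mk m a, rfl⟩

end Map

/-! ### Chang's map to a group with strong unit. -/

section Upsilon

variable {G : Type*} [AddCommGroup G] [Lattice G] [IsOrderedAddMonoid G] [LuGroup G]
  [Nontrivial (Segment G)]

lemma upsilon_mk (m : ℤ) (a : Segment G) :
    upsilon (mk m a) = m • (LuGroup.unit : G) + a.val := rfl

/-- If `a ⊕ b = 1`, then `a ⊙ b = a + b - u`, and the carry in the integer part restores `u`.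
Otherwise totality gives `a + b ≤ u`, so `⊕` is the sum of `G`. -/
lemma upsilon_add (htot : ∀ x y : G, x ≤ y ∨ y ≤ x) (x y : Chang (Segment G)) :
    upsilon (x + y) = upsilon x + upsilon y := by
  obtain ⟨m, a, rfl⟩ := exists_rep x
  obtain ⟨n, b, rfl⟩ := exists_rep y
  by_cases hab : a + b = 1
  · have h := congrArg Segment.val hab
    rw [Segment.val_add, Segment.val_one, inf_eq_left] at h
    have e : (odot a b).val = a.val + b.val - LuGroup.unit := by
      rw [odot, Segment.val_compl, Segment.val_add, Segment.val_compl, Segment.val_compl,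
        inf_of_le_right]
      · abel
      · rw [sub_add_sub_comm, sub_le_iff_le_add]
        exact add_le_add le_rfl h
    rw [mk_add_mk_of_eq hab, upsilon_mk, upsilon_mk, upsilon_mk, e, add_zsmul, add_zsmul,
      one_zsmul]
    abel
  · have e : (a + b).val = a.val + b.val := by
      rw [Segment.val_add]
      refine inf_of_le_right ((htot _ _).resolve_right fun h => hab (Segment.val_injective ?_))
      rw [Segment.val_add, Segment.val_one, inf_of_le_left h]
    rw [mk_add_mk_of_ne hab, upsilon_mk, upsilon_mk, upsilon_mk, e, add_zsmul]
    abel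

lemma upsilon_monotone [MVChain (Segment G)] :
    Monotone (upsilon : Chang (Segment G) → G) := by
  rintro x y ⟨m, a, n, b, rfl, rfl, hlt | ⟨rfl, hab⟩⟩
  · rw [upsilon_mk, upsilon_mk]
    calc m • (LuGroup.unit : G) + a.val ≤ m • LuGroup.unit + LuGroup.unit := by
          gcongr; exact a.val_le
      _ = (m + 1) • LuGroup.unit := by rw [add_zsmul, one_zsmul]
      _ ≤ n • LuGroup.unit := zsmul_left_mono LuGroup.unit_nonneg (by omega)
      _ ≤ n • LuGroup.unit + b.val := le_add_of_nonneg_right b.val_nonneg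
  · rw [upsilon_mk, upsilon_mk]
    gcongr
    exact Segment.le_iff.1 hab

lemma unit_ne_zero : (LuGroup.unit : G) ≠ 0 := by
  intro h
  refine zero_ne_one' (A := Segment G) (Segment.val_injective ?_)
  rw [Segment.val_zero, Segment.val_one, h]

lemma upsilon_injective [MVChain (Segment G)] :
    Function.Injective (upsilon : Chang (Segment G) → G) := by
  have hu : (0 : G) < LuGroup.unit := LuGroup.unit_nonneg.lt_of_ne' unit_ne_zero
  have key : ∀ x y : Chang (Segment G), (upsilon x : G) ≤ upsilon y → x ≤ y := by
    intro x y
    obtain ⟨m, a, rfl⟩ := exists_rep x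
    obtain ⟨n, b, rfl⟩ := exists_rep y
    rw [upsilon_mk, upsilon_mk, mk_le_mk]
    intro h
    rcases lt_trichotomy m n with hmn | rfl | hmn
    · exact Or.inl hmn
    · exact Or.inr (Or.inl ⟨rfl, Segment.le_iff.2 (le_of_add_le_add_left h)⟩)
    -- Here `m u ≤ n u + b ≤ (n + 1) u` forces `m = n + 1`, then `a = 0` and `b = u`: precisely the
    -- identified pairs `(n + 1, 0)` and `(n, 1)`.
    · have h1 : m • (LuGroup.unit : G) ≤ (n + 1) • LuGroup.unit := by
        rw [add_zsmul, one_zsmul]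
        exact ((le_add_of_nonneg_right a.val_nonneg).trans h).trans
          (add_le_add le_rfl b.val_le)
      have h2 : m = n + 1 := by
        by_contra hne
        exact (zsmul_left_strictMono hu (by omega : n + 1 < m)).not_ge h1
      subst h2
      rw [add_zsmul, one_zsmul, add_assoc, add_le_add_iff_left] at h
      refine Or.inr (Or.inr ⟨rfl, Segment.val_injective ?_, Segment.val_injective ?_⟩)
      · rw [Segment.val_zero]
        exact le_antisymm ((add_le_iff_nonpos_right _).1 (h.trans b.val_le)) a.val_nonneg
      · rw [Segment.val_one]
        exact le_antisymm b.val_le ((le_add_of_nonneg_right a.val_nonneg).trans h)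
  exact fun x y hxy => le_antisymm (key x y hxy.le) (key y x hxy.ge)

/-- Division by `u`: with `m` the greatest integer such that `m u ≤ x`, totality gives `x ≤ (m + 1)
u`, so the remainder lies in `[0,u]`. -/
lemma upsilon_surjective (htot : ∀ x y : G, x ≤ y ∨ y ≤ x) :
    Function.Surjective (upsilon : Chang (Segment G) → G) := by
  intro x
  have hu : (0 : G) < LuGroup.unit := LuGroup.unit_nonneg.lt_of_ne' unit_ne_zero
  obtain ⟨n, hn⟩ := LuGroup.exists_abs_le x
  obtain ⟨m, hm, hmax⟩ := Int.exists_greatest_of_bdd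
    (P := fun z : ℤ => z • (LuGroup.unit : G) ≤ x)
    ⟨n, fun z hz => by
      by_contra hlt
      refine (zsmul_left_strictMono hu (not_le.1 hlt)).not_ge (hz.trans ?_)
      beta_reduce
      rw [natCast_zsmul]
      exact (le_abs_self x).trans hn⟩
    ⟨-n, by
      rw [neg_zsmul, natCast_zsmul]
      exact neg_le.1 ((neg_le_abs x).trans hn)⟩
  have h : x ≤ (m + 1) • LuGroup.unit :=
    (htot _ _).resolve_right fun h' => by have := hmax _ h'; omega
  rw [add_zsmul, one_zsmul] at h
  refine ⟨mk m ⟨x - m • LuGroup.unit, sub_nonneg.2 hm, sub_le_iff_le_add'.2 h⟩, ?_⟩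
  exact add_sub_cancel (m • LuGroup.unit) x

end Upsilon

end Chang

/-! ### The isomorphism of products -/

section FiberMap

variable {G : Type*} [AddCommGroup G] [Lattice G] [IsOrderedAddMonoid G] [LuGroup G]

lemma upsilonProd_add (σ τ : StarProd (Segment G)) :
    upsilonProd (σ + τ) = upsilonProd σ + upsilonProd τ := by
  funext P
  change Chang.upsilon (Chang.map P.segmentHom (σ P.trace + τ P.trace)) = _
  rw [Chang.map_add _ P.segmentHom_injective, Chang.upsilon_add P.quot_total]
  rfl

/-- The source is a chain, so monotonicity already gives preservation of joins and meets. -/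
lemma fiberMap_monotone (P : PrimeLIdeal G) :
    Monotone fun s : Chang P.trace.toMVIdeal.Quot =>
      Chang.upsilon (Chang.map P.segmentHom s) :=
  Chang.upsilon_monotone.comp (Chang.map_monotone P.segmentHom)

lemma fiberMap_bijective (P : PrimeLIdeal G) :
    Function.Bijective fun s : Chang P.trace.toMVIdeal.Quot =>
      Chang.upsilon (Chang.map P.segmentHom s) :=
  ⟨Chang.upsilon_injective.comp (Chang.map_injective _ P.segmentHom_injective),
    (Chang.upsilon_surjective P.quot_total).comp
      (Chang.map_surjective _ P.segmentHom_surjective)⟩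

lemma upsilonProd_injective : Function.Injective (upsilonProd (G := G)) := by
  intro σ τ h
  funext Q
  have hQ : ∀ P : PrimeLIdeal G, σ P.trace = τ P.trace := fun P =>
    (fiberMap_bijective P).1 (congrFun h P)
  have := hQ Q.untrace
  rwa [PrimeLIdeal.trace_untrace] at this

lemma upsilonProd_surjective : Function.Surjective (upsilonProd (G := G)) := by
  intro ρ
  -- Asking for all `P` with trace `Q` lets the chosen section be evaluated at `P.trace` without
  -- transport. Since `trace` is injective, only one `P` is concerned.
  have key : ∀ Q : PrimeMVIdeal (Segment G), ∃ s : Chang Q.toMVIdeal.Quot,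
      ∀ (P : PrimeLIdeal G) (h : Q = P.trace),
        Chang.upsilon (Chang.map P.segmentHom (h ▸ s)) = ρ P := by
    intro Q
    obtain ⟨P, rfl⟩ : ∃ P : PrimeLIdeal G, P.trace = Q := ⟨_, PrimeLIdeal.trace_untrace Q⟩
    obtain ⟨s, hs⟩ := (fiberMap_bijective P).2 (ρ P)
    refine ⟨s, fun P' h => ?_⟩
    obtain rfl := PrimeLIdeal.trace_injective h
    exact hs
  choose σ hσ using key
  exact ⟨σ, funext fun P => hσ P.trace P rfl⟩

lemma upsilonProd_iotaHat (x : Segment G) : upsilonProd (iotaHat x) = hatG x.val := by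
  funext P
  change (0 : ℤ) • (LuGroup.unit : P.toLIdeal.Quot) + P.toLIdeal.cls x.val = _
  rw [zero_zsmul, zero_add]
  rfl

lemma upsilonProd_isUnitalLIso :
    IsUnitalLIso (starUnit (Segment G)) (hatG (LuGroup.unit : G)) (upsilonProd (G := G)) where
  map_add := upsilonProd_add
  map_sup σ τ := funext fun P => (fiberMap_monotone P).map_sup (σ P.trace) (τ P.trace)
  map_inf σ τ := funext fun P => (fiberMap_monotone P).map_inf (σ P.trace) (τ P.trace)
  map_unit := by rw [starUnit, upsilonProd_iotaHat, Segment.val_one]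
  bijective := ⟨upsilonProd_injective, upsilonProd_surjective⟩

/-- The map of products `υ` as an additive homomorphism. -/
noncomputable def upsilonProdHom :
    StarProd (Segment G) →+ ∀ P : PrimeLIdeal G, P.toLIdeal.Quot :=
  AddMonoidHom.mk' upsilonProd upsilonProd_add

/-- The diagonal map `x ↦ x̂` as an additive homomorphism. -/
def hatGHom : G →+ ∀ P : PrimeLIdeal G, P.toLIdeal.Quot :=
  AddMonoidHom.mk' hatG fun _ _ => rfl

/-! ### Restriction to the generated subgroup. -/

/-- Both sides are generated by the sections `x̂` with `x ∈ [0,u]`. -/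
lemma map_mvStar :
    (mvStar (Segment G)).map upsilonProdHom = (hatGHom : G →+ _).range := by
  rw [mvStar, AddMonoidHom.map_closure, AddMonoidHom.range_eq_map, ← Segment.closure_range_val,
    AddMonoidHom.map_closure, ← Set.range_comp, ← Set.range_comp]
  congr 2
  exact funext upsilonProd_iotaHat

lemma mem_mvStar_iff {σ : StarProd (Segment G)} :
    σ ∈ mvStar (Segment G) ↔ ∃ x : G, hatG x = upsilonProd σ := by
  have h : upsilonProdHom σ ∈ (mvStar (Segment G)).map upsilonProdHom ↔
      σ ∈ mvStar (Segment G) :=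
    AddSubgroup.mem_map_iff_mem upsilonProd_injective
  rw [← h, map_mvStar]
  rfl

/-- Closure under joins and meets is not visible on generators; it is pulled back from the diagonal,
where `x ↦ x̂` respects the lattice operations. -/
lemma isLuSubgroup_mvStar : IsLuSubgroup (mvStar (Segment G)) (starUnit (Segment G)) where
  sup_mem σ hσ τ hτ := by
    obtain ⟨x, hx⟩ := mem_mvStar_iff.1 hσ
    obtain ⟨y, hy⟩ := mem_mvStar_iff.1 hτ
    refine mem_mvStar_iff.2 ⟨x ⊔ y, ?_⟩
    rw [upsilonProd_isUnitalLIso.map_sup, ← hx, ← hy]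
    rfl
  inf_mem σ hσ τ hτ := by
    obtain ⟨x, hx⟩ := mem_mvStar_iff.1 hσ
    obtain ⟨y, hy⟩ := mem_mvStar_iff.1 hτ
    refine mem_mvStar_iff.2 ⟨x ⊓ y, ?_⟩
    rw [upsilonProd_isUnitalLIso.map_inf, ← hx, ← hy]
    rfl
  unit_mem := iotaHat_mem 1
  unit_nonneg Q := Chang.mk_le_mk.2 (Or.inr (Or.inl ⟨rfl, zero_le' _⟩))
  exists_abs_le σ hσ := by
    obtain ⟨x, hx⟩ := mem_mvStar_iff.1 hσ
    obtain ⟨n, hn⟩ := LuGroup.exists_abs_le x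
    -- The inequality is turned into an equation between joins, which the injective, join-preserving
    -- `υ` reflects.
    refine ⟨n, sup_eq_right.1 (upsilonProd_injective ?_)⟩
    have hneg : upsilonProd (-σ) = -upsilonProd σ := _root_.map_neg upsilonProdHom σ
    have hsmul : upsilonProd (n • starUnit (Segment G)) = n • upsilonProd (starUnit (Segment G)) :=
      _root_.map_nsmul upsilonProdHom n _
    rw [upsilonProd_isUnitalLIso.map_sup, abs, upsilonProd_isUnitalLIso.map_sup, hneg, hsmul,
      upsilonProd_isUnitalLIso.map_unit, ← hx]
    change hatG (|x| ⊔ n • LuGroup.unit) = hatG (n • LuGroup.unit)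
    rw [sup_of_le_right hn]

end FiberMap

theorem mainTheorem4 {G : Type*} [AddCommGroup G] [Lattice G] [IsOrderedAddMonoid G]
    [LuGroup G] :
    -- the fiberwise Chang maps are an isomorphism of the product l-groups
    IsUnitalLIso (starUnit (Segment G)) (hatG (LuGroup.unit : G)) (upsilonProd (G := G)) ∧
    -- `Γ(G,u)^*` is an l_u-group
    ∃ hstar : IsLuSubgroup (mvStar (Segment G)) (starUnit (Segment G)),
      letI : Lattice (mvStar (Segment G)) := hstar.lattice
      -- and they restrict to an isomorphism `Γ(G,u)^* ≅ (G,u)`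
      ∃! υ : mvStar (Segment G) → G,
        (∀ σ : mvStar (Segment G), hatG (υ σ) = upsilonProd (σ : StarProd (Segment G))) ∧
        IsUnitalLIso (⟨starUnit (Segment G), hstar.unit_mem⟩ : mvStar (Segment G))
          (LuGroup.unit : G) υ ∧
        ∀ x : Segment G, υ ⟨iotaHat x, iotaHat_mem x⟩ = x.val := by
  have hiso := upsilonProd_isUnitalLIso (G := G)
  refine ⟨hiso, isLuSubgroup_mvStar, ?_⟩
  let := (isLuSubgroup_mvStar (G := G)).lattice
  -- `υ σ` is the element of `G` whose diagonal section is the image of `σ`.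
  choose υ hυ using fun σ : mvStar (Segment G) => mem_mvStar_iff.1 σ.2
  refine ⟨υ, ⟨hυ, ⟨fun σ τ => ?_, fun σ τ => ?_, fun σ τ => ?_, ?_, fun σ τ h => ?_, fun x => ?_⟩,
    fun x => ?_⟩, fun υ' h' => funext fun σ => ?_⟩
  · apply hatG_injective
    rw [hυ]
    refine (hiso.map_add _ _).trans ?_
    rw [← hυ, ← hυ]
    rfl
  · apply hatG_injective
    rw [hυ]
    refine (hiso.map_sup _ _).trans ?_
    rw [← hυ, ← hυ]
    rfl
  · apply hatG_injective
    rw [hυ]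
    refine (hiso.map_inf _ _).trans ?_
    rw [← hυ, ← hυ]
    rfl
  · apply hatG_injective
    rw [hυ]
    exact hiso.map_unit
  · apply Subtype.ext
    apply upsilonProd_injective
    rw [← hυ, ← hυ, h]
  · obtain ⟨σ, hσ⟩ := hiso.bijective.2 (hatG x)
    refine ⟨⟨σ, mem_mvStar_iff.2 ⟨x, hσ.symm⟩⟩, hatG_injective ?_⟩
    rw [hυ]
    exact hσ
  · apply hatG_injective
    rw [hυ]
    exact upsilonProd_iotaHat x
  -- Uniqueness needs only the prescribed classes modulo every prime.
  · apply hatG_injective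
    rw [h'.1, hυ]
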